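/- Let $\mathcal{A}$ be a finite alphabet and let $\Sigma \subset \mathcal{A}^{\mathbb{Z}}$ be a subshift, that is, a closed subset (for the product of the discrete topologies) that is invariant under the shift $\tau$, $(\tau x)_n = x_{n+1}$, and its inverse; $\Sigma$ is not assumed to be minimal. Suppose that no $\tau$-periodic point of $\Sigma$ is isolated in $\Sigma$, and that the complexity $\rho$ of $\Sigma$, where $\rho(n)$ is the number of words of length $n$ that appear as sub-words of sequences in $\Sigma$, satisfies \[\lim_{n\to\infty}\left(\frac{\log n}{n}\right)^2\rho(n)=0.\] Then the topological full group $[[\tau]]$, that is, the group of all homeomorphisms $g$ of $\Sigma$ such that every $x\in\Sigma$ has an open neighbourhood $U$ in $\Sigma$ with $g|_U=\tau^k|_U$ for some $k\in\mathbb{Z}$, is amenable as a discrete group: there is a finitely additive probability measure, defined on all subsets of $[[\tau]]$, that is invariant under left translations. -/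

import Mathlib

open Filter Topology

/-- The topological full group `[[τ]]` of a homeomorphism `τ`: the homeomorphisms that coincide
with a power of `τ` on a neighbourhood of every point. Multiplication is composition. -/
def topologicalFullGroup {X : Type*} [TopologicalSpace X] (τ : X ≃ₜ X) : Subgroup (X ≃ₜ X) where
  carrier := {g | ∀ x : X, ∃ U : Set X, IsOpen U ∧ x ∈ U ∧ ∃ k : ℤ, ∀ y ∈ U, g y = (τ ^ k) y}
  one_mem' := fun _ => ⟨Set.univ, isOpen_univ, trivial, 0, fun _ _ => rfl⟩
  mul_mem' := by
    intro g h hg hh x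
    obtain ⟨U, hU, hxU, k, hk⟩ := hh x
    obtain ⟨V, hV, hxV, l, hl⟩ := hg (h x)
    refine ⟨U ∩ h ⁻¹' V, hU.inter (hV.preimage h.continuous), ⟨hxU, hxV⟩, l + k, ?_⟩
    intro y hy
    rw [zpow_add, Homeomorph.mul_apply, Homeomorph.mul_apply, hl _ hy.2, hk _ hy.1]
  inv_mem' := by
    intro g hg x
    obtain ⟨U, hU, hxU, k, hk⟩ := hg (g⁻¹ x)
    refine ⟨(g⁻¹ : X ≃ₜ X) ⁻¹' U, hU.preimage (g⁻¹ : X ≃ₜ X).continuous, hxU, -k, ?_⟩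
    intro y hy
    have h1 : g (g⁻¹ y) = y := g.apply_symm_apply y
    have h2 : (τ ^ (-k)) ((τ ^ k) (g⁻¹ y)) = g⁻¹ y := by
      rw [← Homeomorph.mul_apply, ← zpow_add, neg_add_cancel, zpow_zero]
      rfl
    rw [← hk _ hy, h1] at h2
    exact h2.symm

/-- A (discrete) group is amenable if it carries a finitely additive probability measure, defined
on all of its subsets and invariant under left translations. -/
def IsAmenable (G : Type*) [Group G] : Prop :=
  ∃ m : Set G → ℝ, (∀ s, 0 ≤ m s) ∧ m Set.univ = 1 ∧
    (∀ s t, Disjoint s t → m (s ∪ t) = m s + m t) ∧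
    ∀ (g : G) (s : Set G), m ((fun h => g * h) '' s) = m s

namespace SymbolicDynamics.FullShift.Subshift

/-- The left shift `(τ x)ₙ = xₙ₊₁` as a homeomorphism of a subshift of `A^ℤ`. -/
def shiftHomeomorph {A : Type*} [TopologicalSpace A] (Y : Subshift A ℤ) :
    Y.carrier ≃ₜ Y.carrier where
  toFun x := ⟨shift 1 x.1, Y.mapsTo 1 x.2⟩
  invFun x := ⟨shift (-1) x.1, Y.mapsTo (-1) x.2⟩
  left_inv x := by
    ext n
    simp
  right_inv x := by
    ext n
    simp
  continuous_toFun := by fun_prop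
  continuous_invFun := by fun_prop

/-- The words of length `n` that appear as sub-words of the sequences of a subshift. -/
def words {A : Type*} [TopologicalSpace A] (Y : Subshift A ℤ) (n : ℕ) : Set (Fin n → A) :=
  {w | ∃ x ∈ Y.carrier, ∃ i : ℤ, ∀ j : Fin n, x (i + (j : ℕ)) = w j}

/-- The complexity `ρ(n)` of a subshift over a finite alphabet: the number of words of
length `n` that appear in it. -/
noncomputable def complexity {A : Type*} [TopologicalSpace A] (Y : Subshift A ℤ) (n : ℕ) : ℕ :=
  (Y.words n).ncard

end SymbolicDynamics.FullShift.Subshift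

/-! Run the lazy symmetric random walk driven by a finite subset of `[[τ]]`. By a Kesten-type
criterion (`isAmenable_of_walkLaw`) it suffices that the squared `ℓ²` norm of its law does not decay
exponentially in the time `n`. By Cauchy–Schwarz this follows if, for arbitrarily large `n`, the
walk lies with probability at least 1/2 in a set of `exp (o(n))` group elements.

Such a set is found by looking at orbits. An element of `[[τ]]` acts as `g x = τ ^ k(x) x` with `k`
bounded and dependent only on a window of radius `r` (`exists_cocycle`), so the walk moves each
point `x` along its orbit as a walk on `ℤ` with bounded jumps. While this walk stays in `[-m, m]`,
it depends only on the word of `x` on `[-(m+r), m+r]` (`walk_eq_of_window_eq`). Take one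
representative for each of the `ρ = ρ(2(m+r)+1)` words: if none of their walks leaves `[-m, m]`, the
group element is determined by their `ρ` final positions, which leaves at most `(2m+1)^ρ` elements
(`one_le_card_mul_tsum_walkLaw_sq`).

The Gaussian bound `walkLaw_le_exp` makes an exit before time `n ≈ m² / log m` so unlikely that a
union bound over the `ρ` words is affordable. At this scale `ρ log m = o(n)` is the hypothesis on
the complexity (`exists_time_scale`). -/

/-! ### Almost invariant means and amenability. -/

/-- A finitely additive probability measure on all subsets of `G`. -/
structure IsMean {G : Type*} (m : Set G → ℝ) : Prop where
  nonneg : ∀ s, 0 ≤ m s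
  univ : m Set.univ = 1
  union : ∀ s t, Disjoint s t → m (s ∪ t) = m s + m t

theorem IsMean.le_one {G : Type*} {m : Set G → ℝ} (h : IsMean m) (s : Set G) : m s ≤ 1 := by
  have h1 := h.union s sᶜ disjoint_compl_right
  rw [Set.union_compl_self, h.univ] at h1
  linarith [h.nonneg sᶜ]

/-- Values of means lie in the compact interval `[0, 1]`, so an ultrafilter finer than `atTop` on
pairs (finite set, precision) gives a pointwise limit, which is exactly invariant. -/
theorem isAmenable_of_almost_invariant {G : Type*} [Group G]
    (H : ∀ (S : Finset G) (ε : ℝ), 0 < ε → ∃ m : Set G → ℝ, IsMean m ∧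
      ∀ g ∈ S, ∀ s : Set G, |m ((fun h => g * h) '' s) - m s| ≤ ε) :
    IsAmenable G := by
  classical
  choose! m hm hinv using H
  let p : Finset G × ℕ → Set G → ℝ := fun i => m i.1 (1 / ((i.2 : ℝ) + 1))
  have hp : ∀ i, IsMean (p i) := fun i => hm _ _ (by positivity)
  obtain ⟨U, hU⟩ := Ultrafilter.exists_le (atTop : Filter (Finset G × ℕ))
  have hlim : ∀ s, ∃ a ∈ Set.Icc (0 : ℝ) 1, Tendsto (fun i => p i s) U (𝓝 a) := by
    intro s
    have := (isCompact_Icc (a := (0 : ℝ)) (b := 1)).ultrafilter_le_nhds (U.map fun i => p i s)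
      (by
        rw [le_principal_iff]
        exact Filter.mem_map.2 (Filter.univ_mem' fun i => ⟨(hp i).nonneg s, (hp i).le_one s⟩))
    exact this
  choose μ hμ hμlim using hlim
  refine ⟨μ, fun s => (hμ s).1, ?_, ?_, ?_⟩
  · refine tendsto_nhds_unique (hμlim _) ?_
    simp only [(hp _).univ]
    exact tendsto_const_nhds
  · intro s t hst
    refine tendsto_nhds_unique (hμlim _) ?_
    simp only [(hp _).union s t hst]
    exact (hμlim s).add (hμlim t)
  · intro g s
    have h1 := (hμlim ((fun h => g * h) '' s)).sub (hμlim s)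
    have h2 : Tendsto (fun i => p i ((fun h => g * h) '' s) - p i s) U (𝓝 0) := by
      have h3 : Tendsto (fun i : Finset G × ℕ => 1 / ((i.2 : ℝ) + 1)) atTop (𝓝 0) := by
        rw [← prod_atTop_atTop_eq]
        exact tendsto_one_div_add_atTop_nhds_zero_nat.comp tendsto_snd
      refine squeeze_zero_norm' ?_ (h3.mono_left hU)
      refine hU ?_
      filter_upwards [eventually_ge_atTop (({g} : Finset G), 0)] with i hi
      exact hinv _ _ (by positivity) g (hi.1 (Finset.mem_singleton_self g)) s
    exact sub_eq_zero.1 (tendsto_nhds_unique h1 h2)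

theorem isMean_of_weight {G : Type*} {p : G → ℝ} (h0 : ∀ g, 0 ≤ p g) (hp : Summable p)
    (h1 : ∑' g, p g = 1) : IsMean fun s => ∑' g, s.indicator p g where
  nonneg s := tsum_nonneg fun g => Set.indicator_nonneg (fun g _ => h0 g) g
  univ := by simpa using h1
  union s t hst := by
    rw [← (hp.indicator s).tsum_add (hp.indicator t)]
    congr 1 with g
    rw [Set.indicator_union_of_disjoint hst]

theorem sq_avg_le {ι : Type*} [Fintype ι] (x : ι → ℝ) :
    ((∑ i, x i) / Fintype.card ι) ^ 2 ≤ (∑ i, x i ^ 2) / Fintype.card ι := by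
  rcases Nat.eq_zero_or_pos (Fintype.card ι) with h | h
  · simp [h]
  have h' : (0 : ℝ) < Fintype.card ι := by exact_mod_cast h
  have := sq_sum_le_card_mul_sum_sq (s := Finset.univ) (f := x)
  rw [div_pow, div_le_div_iff₀ (by positivity) h']
  rw [Finset.card_univ] at this
  nlinarith

/-- The bracket is the variance of `x`, and each squared deviation from the average is at most the
cardinality times the variance. -/
theorem sq_sub_le_of_sum {ι : Type*} [Fintype ι] [Nonempty ι] (x : ι → ℝ) (i j : ι) :
    (x i - x j) ^ 2 ≤ 4 * Fintype.card ι *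
      ((∑ k, x k ^ 2) / Fintype.card ι - ((∑ k, x k) / Fintype.card ι) ^ 2) := by
  have h' : (0 : ℝ) < Fintype.card ι := by exact_mod_cast Fintype.card_pos
  set a := (∑ k, x k) / Fintype.card ι with ha
  have hsum : ∑ k, x k = Fintype.card ι * a := by rw [ha]; field_simp
  have h1 : ∑ k, (x k - a) ^ 2 = ∑ k, x k ^ 2 - Fintype.card ι * a ^ 2 := by
    simp only [sub_sq, Finset.sum_add_distrib, Finset.sum_sub_distrib, ← Finset.sum_mul,
      ← Finset.mul_sum, hsum, Finset.sum_const, Finset.card_univ, nsmul_eq_mul]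
    ring
  have h2 : ∀ k, (x k - a) ^ 2 ≤ ∑ k, (x k - a) ^ 2 := fun k =>
    Finset.single_le_sum (f := fun k => (x k - a) ^ 2) (fun _ _ => sq_nonneg _) (Finset.mem_univ k)
  have h3 : 4 * Fintype.card ι * ((∑ k, x k ^ 2) / Fintype.card ι - a ^ 2)
      = 4 * ∑ k, (x k - a) ^ 2 := by
    rw [h1]; field_simp
  rw [h3]
  nlinarith [h2 i, h2 j, sq_nonneg ((x i - a) + (x j - a))]

theorem summable_sq_avg {ι Z : Type*} [Fintype ι] {f : ι → Z → ℝ}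
    (hf : ∀ i, Summable fun z => f i z ^ 2) :
    Summable fun z => ((∑ i, f i z) / Fintype.card ι) ^ 2 :=
  Summable.of_nonneg_of_le (fun _ => sq_nonneg _) (fun z => sq_avg_le fun i => f i z)
    ((summable_sum fun i _ => hf i).div_const _)

/-- Averaging translates of `f` loses exactly their total variance in squared norm. If little is
lost, all translates are close to each other, and `f` itself is one of them thanks to the letter
`t₀`. -/
theorem tsum_sq_translate_sub_le {G T : Type*} [Group G] [Fintype T] [Nonempty T] (σ : T → G)
    (t₀ : T) (ht₀ : σ t₀ = 1) {f : G → ℝ} (hf : Summable fun g => f g ^ 2) {ε : ℝ}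
    (h : (1 - ε ^ 2 / (4 * Fintype.card T)) * ∑' g, f g ^ 2 ≤
      ∑' g, ((∑ t, f ((σ t)⁻¹ * g)) / Fintype.card T) ^ 2) (t : T) :
    Summable (fun g => (f ((σ t)⁻¹ * g) - f g) ^ 2) ∧
      ∑' g, (f ((σ t)⁻¹ * g) - f g) ^ 2 ≤ ε ^ 2 * ∑' g, f g ^ 2 := by
  set a := ∑' g, f g ^ 2 with ha
  have hc : (0 : ℝ) < Fintype.card T := by exact_mod_cast Fintype.card_pos
  have hft : ∀ g₀ : G, Summable fun g => f (g₀ * g) ^ 2 := fun g₀ =>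
    (Equiv.summable_iff (f := fun g => f g ^ 2) (Equiv.mulLeft g₀)).2 hf
  have htt : ∀ g₀ : G, ∑' g, f (g₀ * g) ^ 2 = a := fun g₀ =>
    (Equiv.mulLeft g₀).tsum_eq fun g => f g ^ 2
  have hle : ∀ g, (f ((σ t)⁻¹ * g) - f g) ^ 2 ≤ 4 * Fintype.card T *
    ((∑ k, f ((σ k)⁻¹ * g) ^ 2) / Fintype.card T -
      ((∑ k, f ((σ k)⁻¹ * g)) / Fintype.card T) ^ 2) := by
    intro g
    have := sq_sub_le_of_sum (fun k => f ((σ k)⁻¹ * g)) t t₀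
    simpa [ht₀] using this
  have hs1 : Summable fun g => (∑ k, f ((σ k)⁻¹ * g) ^ 2) / (Fintype.card T : ℝ) :=
    (summable_sum fun k _ => hft (σ k)⁻¹).div_const _
  have hs2 : Summable fun g => ((∑ k, f ((σ k)⁻¹ * g)) / (Fintype.card T : ℝ)) ^ 2 :=
    summable_sq_avg fun k => hft (σ k)⁻¹
  have hs3 := (hs1.sub hs2).mul_left (4 * (Fintype.card T : ℝ))
  have hs4 := Summable.of_nonneg_of_le (fun _ => sq_nonneg _) hle hs3
  refine ⟨hs4, (hs4.tsum_le_tsum hle hs3).trans ?_⟩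
  rw [tsum_mul_left, hs1.tsum_sub hs2, tsum_div_const,
    Summable.tsum_finsetSum fun k _ => hft (σ k)⁻¹]
  simp only [htt, Finset.sum_const, Finset.card_univ, nsmul_eq_mul]
  rw [mul_div_cancel_left₀ _ hc.ne']
  have h5 : 4 * (Fintype.card T : ℝ) * (a - (1 - ε ^ 2 / (4 * Fintype.card T)) * a)
      = ε ^ 2 * a := by field_simp; ring
  rw [← h5]
  gcongr

theorem abs_sq_sub_sq_le {ε : ℝ} (hε : 0 < ε) (x y : ℝ) :
    |y ^ 2 - x ^ 2| ≤ 1 / (2 * ε) * (x - y) ^ 2 + ε * (x ^ 2 + y ^ 2) := by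
  have h1 : (1 / (2 * ε)) * (x - y) ^ 2 + ε / 2 * (x + y) ^ 2 - |y ^ 2 - x ^ 2| =
      1 / (2 * ε) * (|x - y| - ε * |x + y|) ^ 2 := by
    have : y ^ 2 - x ^ 2 = -((x - y) * (x + y)) := by ring
    rw [this, abs_neg, abs_mul, ← sq_abs (x - y), ← sq_abs (x + y)]
    field_simp
    ring
  have h2 : 0 ≤ 1 / (2 * ε) * (|x - y| - ε * |x + y|) ^ 2 := by positivity
  nlinarith [mul_nonneg hε.le (sq_nonneg (x - y))]

/-- The density `f² / a` turns an almost invariant `ℓ²` vector into an almost invariant mean.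
Weighting AM-GM by `ε` bounds the error by `ε/2 + 2ε`. -/
theorem abs_mean_translate_sub_le {G : Type*} [Group G] (g₀ : G) {f : G → ℝ} {a : ℝ}
    (hf : HasSum (fun g => f g ^ 2) a) (hpos : 0 < a) {ε : ℝ} (hε : 0 < ε)
    (hd : Summable fun g => (f (g₀⁻¹ * g) - f g) ^ 2)
    (hd' : ∑' g, (f (g₀⁻¹ * g) - f g) ^ 2 ≤ ε ^ 2 * a) (s : Set G) :
    |∑' g, ((fun h => g₀ * h) '' s).indicator (fun g => f g ^ 2 / a) g -
      ∑' g, s.indicator (fun g => f g ^ 2 / a) g| ≤ 3 * ε := by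
  have hp : Summable fun g => f g ^ 2 / a := hf.summable.div_const a
  have hft : HasSum (fun g => f (g₀⁻¹ * g) ^ 2) a :=
    (Equiv.hasSum_iff (f := fun g => f g ^ 2) (Equiv.mulLeft g₀⁻¹)).2 hf
  have hF : Summable (((fun h => g₀ * h) '' s).indicator fun g => f g ^ 2 / a) := hp.indicator _
  have hF' : Summable fun g => s.indicator (fun g => f g ^ 2 / a) (g₀⁻¹ * g) :=
    (Equiv.summable_iff (f := s.indicator fun g => f g ^ 2 / a) (Equiv.mulLeft g₀⁻¹)).2
      (hp.indicator s)
  have hms : ∑' g, s.indicator (fun g => f g ^ 2 / a) g =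
      ∑' g, s.indicator (fun g => f g ^ 2 / a) (g₀⁻¹ * g) :=
    ((Equiv.mulLeft g₀⁻¹).tsum_eq (s.indicator fun g => f g ^ 2 / a)).symm
  have hB : HasSum (fun g => (1 / (2 * ε) * (f (g₀⁻¹ * g) - f g) ^ 2 +
      ε * (f (g₀⁻¹ * g) ^ 2 + f g ^ 2)) / a)
      ((1 / (2 * ε) * (∑' g, (f (g₀⁻¹ * g) - f g) ^ 2) + ε * (a + a)) / a) :=
    ((hd.hasSum.mul_left _).add ((hft.add hf).mul_left _)).div_const a
  rw [hms, ← hF.tsum_sub hF', ← Real.norm_eq_abs]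
  refine (tsum_of_norm_bounded hB fun g => ?_).trans ?_
  · have hmem : g ∈ (fun h => g₀ * h) '' s ↔ g₀⁻¹ * g ∈ s := by
      rw [Set.image_mul_left, Set.mem_preimage]
    by_cases hg : g₀⁻¹ * g ∈ s
    · rw [Set.indicator_of_mem (hmem.2 hg), Set.indicator_of_mem hg, Real.norm_eq_abs, ← sub_div,
        abs_div, abs_of_pos hpos]
      exact div_le_div_of_nonneg_right (abs_sq_sub_sq_le hε _ _) hpos.le
    · rw [Set.indicator_of_notMem (fun h => hg (hmem.1 h)), Set.indicator_of_notMem hg, sub_zero,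
        norm_zero]
      exact div_nonneg (add_nonneg (mul_nonneg (by positivity) (sq_nonneg _))
        (mul_nonneg hε.le (add_nonneg (sq_nonneg _) (sq_nonneg _)))) hpos.le
  · rw [div_le_iff₀ hpos]
    have h7 : 1 / (2 * ε) * (∑' g, (f (g₀⁻¹ * g) - f g) ^ 2) ≤ 1 / (2 * ε) * (ε ^ 2 * a) :=
      mul_le_mul_of_nonneg_left hd' (by positivity)
    have h8 : 1 / (2 * ε) * (ε ^ 2 * a) = ε * a / 2 := by field_simp
    nlinarith [mul_pos hε hpos]

theorem exists_almost_invariant_mean {G T : Type*} [Group G] [Fintype T] [Nonempty T] (σ : T → G)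
    (t₀ : T) (ht₀ : σ t₀ = 1) {f : G → ℝ} (hf : Summable fun g => f g ^ 2)
    (hpos : 0 < ∑' g, f g ^ 2) {ε : ℝ} (hε : 0 < ε)
    (h : (1 - ε ^ 2 / (4 * Fintype.card T)) * ∑' g, f g ^ 2 ≤
      ∑' g, ((∑ t, f ((σ t)⁻¹ * g)) / Fintype.card T) ^ 2) :
    ∃ m : Set G → ℝ, IsMean m ∧
      ∀ t, ∀ s : Set G, |m ((fun h => σ t * h) '' s) - m s| ≤ 3 * ε := by
  refine ⟨fun s => ∑' g, s.indicator (fun g => f g ^ 2 / ∑' g, f g ^ 2) g,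
    isMean_of_weight (fun g => by positivity) (hf.div_const _) ?_, fun t s => ?_⟩
  · rw [tsum_div_const, div_self hpos.ne']
  · obtain ⟨hd, hd'⟩ := tsum_sq_translate_sub_le σ t₀ ht₀ hf h t
    exact abs_mean_translate_sub_le (σ t) hf.hasSum hpos hε hd hd' s


/-! ### Random walks and a Kesten-type criterion. -/

/-- The average of `F` over all words of length `n` in the alphabet `T`. -/
noncomputable def wordAvg {T : Type*} [Fintype T] : ℕ → (List T → ℝ) → ℝ
  | 0, F => F []
  | n + 1, F => (∑ t, wordAvg n fun w => F (t :: w)) / Fintype.card T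

section WordAvg

variable {T : Type*} [Fintype T]

theorem wordAvg_mono (n : ℕ) {F F' : List T → ℝ} (h : ∀ w, w.length = n → F w ≤ F' w) :
    wordAvg n F ≤ wordAvg n F' := by
  induction n generalizing F F' with
  | zero => exact h [] rfl
  | succ n ih =>
    unfold wordAvg
    gcongr with t
    exact ih fun w hw => h _ (by simp [hw])

theorem wordAvg_add (n : ℕ) (F F' : List T → ℝ) :
    wordAvg n (fun w => F w + F' w) = wordAvg n F + wordAvg n F' := by
  induction n generalizing F F' with
  | zero => rfl
  | succ n ih => simp only [wordAvg, ih, Finset.sum_add_distrib, add_div]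

theorem wordAvg_const [Nonempty T] (n : ℕ) (c : ℝ) : wordAvg n (fun _ : List T => c) = c := by
  induction n with
  | zero => rfl
  | succ n ih =>
    simp only [wordAvg, ih, Finset.sum_const, Finset.card_univ, nsmul_eq_mul]
    field_simp

theorem wordAvg_zero_fun (n : ℕ) : wordAvg n (fun _ : List T => 0) = 0 := by
  induction n with
  | zero => rfl
  | succ n ih => simp [wordAvg, ih]

theorem wordAvg_sum {ι : Type*} (n : ℕ) (s : Finset ι) (F : ι → List T → ℝ) :
    wordAvg n (fun w => ∑ i ∈ s, F i w) = ∑ i ∈ s, wordAvg n (F i) := by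
  classical
  induction s using Finset.induction_on with
  | empty => simp [wordAvg_zero_fun]
  | insert i s hi ih => simp only [Finset.sum_insert hi, wordAvg_add, ih]

theorem wordAvg_nonneg (n : ℕ) {F : List T → ℝ} (h : ∀ w, 0 ≤ F w) : 0 ≤ wordAvg n F := by
  rw [← wordAvg_zero_fun (T := T) n]
  exact wordAvg_mono n fun w _ => h w

/-- The law at time `n` of the random walk driven by `σ` for an action on `Z`, started at `z₀`. -/
noncomputable def walkLaw {G Z : Type*} [Group G] [MulAction G Z] [DecidableEq Z] (σ : T → G)
    (z₀ : Z) (n : ℕ) (z : Z) : ℝ :=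
  wordAvg n fun w => if (w.map σ).prod • z₀ = z then 1 else 0

variable {G Z : Type*} [Group G] [MulAction G Z] [DecidableEq Z] (σ : T → G) (z₀ : Z)

theorem walkLaw_zero : walkLaw σ z₀ 0 = Pi.single z₀ 1 := by
  ext z
  simp only [walkLaw, wordAvg, List.map_nil, List.prod_nil, one_smul, Pi.single_apply, eq_comm]

theorem walkLaw_succ (n : ℕ) (z : Z) :
    walkLaw σ z₀ (n + 1) z = (∑ t, walkLaw σ z₀ n ((σ t)⁻¹ • z)) / Fintype.card T := by
  simp only [walkLaw, wordAvg, List.map_cons, List.prod_cons, mul_smul, eq_inv_smul_iff]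

theorem summable_walkLaw_sq (n : ℕ) : Summable fun z => walkLaw σ z₀ n z ^ 2 := by
  induction n with
  | zero =>
    rw [walkLaw_zero]
    refine summable_of_ne_finset_zero (s := {z₀}) fun z hz => ?_
    simp [Pi.single_eq_of_ne (Finset.notMem_singleton.1 hz)]
  | succ n ih =>
    simp only [walkLaw_succ]
    refine summable_sq_avg fun t => ?_
    exact (Equiv.summable_iff (f := fun z => walkLaw σ z₀ n z ^ 2)
      (MulAction.toPerm (σ t)⁻¹)).2 ih

theorem tsum_walkLaw_zero_sq : ∑' z, walkLaw σ z₀ 0 z ^ 2 = 1 := by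
  rw [walkLaw_zero, tsum_eq_single z₀ fun z hz => by simp [Pi.single_eq_of_ne hz]]
  simp

end WordAvg

theorem tsum_walkLaw_sq_succ_le {T G Z : Type*} [Fintype T] [Nonempty T] [Group G] [MulAction G Z]
    [DecidableEq Z] (σ : T → G) (z₀ : Z) (n : ℕ) :
    ∑' z, walkLaw σ z₀ (n + 1) z ^ 2 ≤ ∑' z, walkLaw σ z₀ n z ^ 2 := by
  have hc : (0 : ℝ) < Fintype.card T := by exact_mod_cast Fintype.card_pos
  have h : ∀ t, HasSum (fun z => walkLaw σ z₀ n ((σ t)⁻¹ • z) ^ 2) (∑' z, walkLaw σ z₀ n z ^ 2) :=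
    fun t => (Equiv.hasSum_iff (f := fun z => walkLaw σ z₀ n z ^ 2)
      (MulAction.toPerm (σ t)⁻¹)).2 (summable_walkLaw_sq σ z₀ n).hasSum
  have h' := (hasSum_sum fun t (_ : t ∈ Finset.univ) => h t).div_const (Fintype.card T : ℝ)
  simp only [Finset.sum_const, Finset.card_univ, nsmul_eq_mul] at h'
  rw [mul_div_cancel_left₀ _ hc.ne'] at h'
  refine hasSum_le (fun z => ?_) (summable_walkLaw_sq σ z₀ (n + 1)).hasSum h'
  rw [walkLaw_succ]
  exact sq_avg_le _

/-- If every step lost a factor `1 - ε ≤ exp (-ε)`, then `a n ≤ exp (-ε n)`. -/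
theorem exists_ratio_ge {a : ℕ → ℝ} (h0 : a 0 ≤ 1) (hmono : ∀ n, a (n + 1) ≤ a n)
    (hfreq : ∀ ε : ℝ, 0 < ε → ∃ᶠ n : ℕ in atTop, Real.exp (-ε * n) / 4 ≤ a n) {ε : ℝ}
    (hε : 0 < ε) : ∃ n, (1 - ε) * a n ≤ a (n + 1) ∧ 0 < a n := by
  by_contra! H
  have hle : ∀ n : ℕ, a n ≤ Real.exp (-ε * n) := by
    intro n
    induction n with
    | zero => simpa using h0
    | succ n ih =>
      have hexp : Real.exp (-ε * (n + 1 : ℕ)) = Real.exp (-ε) * Real.exp (-ε * n) := by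
        rw [← Real.exp_add]; push_cast; ring_nf
      rcases le_or_gt (a n) 0 with h | h
      · exact ((hmono n).trans h).trans (Real.exp_pos _).le
      · have h1 : a (n + 1) < (1 - ε) * a n := by
          by_contra! h2
          exact absurd (H n h2) (not_le.2 h)
        rw [hexp]
        have h2 : 1 - ε ≤ Real.exp (-ε) := by linarith [Real.add_one_le_exp (-ε)]
        calc a (n + 1) ≤ (1 - ε) * a n := h1.le
          _ ≤ Real.exp (-ε) * a n := by gcongr
          _ ≤ _ := by gcongr
  have hev : ∀ᶠ n : ℕ in atTop, 4 < ε / 2 * n :=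
    (tendsto_natCast_atTop_atTop.const_mul_atTop (half_pos hε)).eventually_gt_atTop 4
  -- The slower rate `ε / 2` leaves a factor `exp (ε n / 2)`, which eventually beats the constant 4.
  obtain ⟨n, hn, hn'⟩ := ((hfreq (ε / 2) (half_pos hε)).and_eventually hev).exists
  have h1 := hn.trans (hle n)
  have h2 : Real.exp (-(ε / 2) * n) = Real.exp (ε / 2 * n) * Real.exp (-ε * n) := by
    rw [← Real.exp_add]; ring_nf
  rw [h2] at h1
  have h3 := Real.add_one_le_exp (ε / 2 * n)
  have h4 := Real.exp_pos (-ε * n)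
  nlinarith

universe u in
/-- If the return probabilities of all finitely supported walks containing the trivial letter do
not decay exponentially, then the group is amenable. -/
theorem isAmenable_of_walkLaw {G : Type u} [Group G] [DecidableEq G]
    (H : ∀ S : Finset G, ∃ (T : Type u) (_ : Fintype T) (_ : Nonempty T) (σ : T → G),
      (∀ g ∈ S, ∃ t, σ t = g) ∧ (∃ t, σ t = 1) ∧ ∀ ε : ℝ, 0 < ε → ∃ᶠ n : ℕ in atTop,
        Real.exp (-ε * n) / 4 ≤ ∑' g, walkLaw σ (1 : G) n g ^ 2) :
    IsAmenable G := by
  refine isAmenable_of_almost_invariant fun S ε hε => ?_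
  obtain ⟨T, _, _, σ, hS, ⟨t₀, ht₀⟩, hfreq⟩ := H S
  have hc : (0 : ℝ) < Fintype.card T := by exact_mod_cast Fintype.card_pos
  obtain ⟨n, hn, hpos⟩ := exists_ratio_ge (tsum_walkLaw_zero_sq σ (1 : G)).le
    (tsum_walkLaw_sq_succ_le σ (1 : G)) hfreq (ε := (ε / 3) ^ 2 / (4 * Fintype.card T))
    (by positivity)
  simp only [walkLaw_succ, smul_eq_mul] at hn
  obtain ⟨m, hm, hinv⟩ := exists_almost_invariant_mean σ t₀ ht₀ (summable_walkLaw_sq σ (1 : G) n)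
    hpos (ε := ε / 3) (by positivity) hn
  refine ⟨m, hm, fun g hg s => ?_⟩
  obtain ⟨t, rfl⟩ := hS g hg
  exact (hinv t s).trans_eq (by ring)

/-! ### Gaussian bounds and exit probabilities for walks on `ℤ`. -/

/-- The letters of the lazy symmetric random walk generated by `σ`. -/
def lazyLetter {G S : Type*} [Group G] (σ : S → G) (t : S × Fin 4) : G :=
  ![1, 1, σ t.1, (σ t.1)⁻¹] t.2

theorem sq_add_le_two_mul (a q w : ℝ) :
    (a + w) ^ 2 ≤ 2 * a ^ 2 + 2 * q ^ 2 + 4 * a * (w - q) + 2 * (w - q) ^ 2 := by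
  nlinarith [sq_nonneg (a - q + (w - q))]

/-- The symmetric combination is of second order because `exp t * exp (-t) = 1` makes it, up to
sign, a product of two first-order factors. -/
theorem exp_sub_one_bounds {t θ : ℝ} (ht : |t| ≤ θ) (hθ : θ ≤ 1) :
    (Real.exp t - 1) ^ 2 ≤ 4 * θ ^ 2 ∧ |Real.exp t + Real.exp (-t) - 2| ≤ 4 * θ ^ 2 := by
  have h1 := Real.abs_exp_sub_one_le (ht.trans hθ)
  have h2 := Real.abs_exp_sub_one_le (x := -t) (by rw [abs_neg]; exact ht.trans hθ)
  rw [abs_neg] at h2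
  have h3 : Real.exp t * Real.exp (-t) = 1 := by rw [← Real.exp_add]; simp
  have h4 : Real.exp t + Real.exp (-t) - 2 = -((Real.exp t - 1) * (Real.exp (-t) - 1)) := by
    linear_combination h3
  refine ⟨?_, ?_⟩
  · rw [← sq_abs]
    nlinarith [abs_nonneg t, abs_nonneg (Real.exp t - 1)]
  · rw [h4, abs_neg, abs_mul]
    have := mul_le_mul h1 h2 (abs_nonneg _) (by positivity)
    nlinarith [abs_nonneg t]

/-- In the use below, `y, z, x` are the values at `i`, `π i`, `π⁻¹ i`. Replacing `α - 1` by `-(α' -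
1)` costs only second order and puts the first-order terms in a form that telescopes along the
orbits of `π`. -/
theorem sq_twisted_le {x y z α α' β θ : ℝ} (hα : (α - 1) ^ 2 ≤ 4 * θ ^ 2)
    (hα' : |α + α' - 2| ≤ 4 * θ ^ 2) (hβ : (β - 1) ^ 2 ≤ 4 * θ ^ 2) :
    ((2 * y + α * z + β * x) / 4) ^ 2 ≤ (2 * y ^ 2 + (1 + 4 * θ ^ 2) * (z ^ 2 + x ^ 2) +
      4 * θ ^ 2 * (y ^ 2 + z ^ 2) + 2 * ((β - 1) * x * y - (α' - 1) * y * z)) / 4 := by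
  have h1 := sq_add_le_two_mul y ((z + x) / 2) ((α * z + β * x) / 2)
  have h2 : ((z + x) / 2) ^ 2 ≤ (z ^ 2 + x ^ 2) / 2 := by nlinarith [sq_nonneg (z - x)]
  have h3 : ((α * z + β * x) / 2 - (z + x) / 2) ^ 2 ≤ 2 * θ ^ 2 * (z ^ 2 + x ^ 2) := by
    have := mul_le_mul_of_nonneg_right hα (sq_nonneg z)
    have := mul_le_mul_of_nonneg_right hβ (sq_nonneg x)
    nlinarith [sq_nonneg ((α - 1) * z - (β - 1) * x)]
  have h4 : (α + α' - 2) * (y * z) ≤ 4 * θ ^ 2 * ((y ^ 2 + z ^ 2) / 2) := by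
    refine (le_abs_self _).trans ?_
    rw [abs_mul, abs_mul]
    gcongr
    nlinarith [sq_nonneg (|y| - |z|), sq_abs y, sq_abs z]
  nlinarith

/-- The lazy symmetric step along a permutation of bounded displacement, twisted by an exponential
weight, is almost a contraction of `ℓ²`. -/
theorem tsum_sq_twisted_step_le {π : Equiv.Perm ℤ} {R lam : ℝ}
    (hπ : ∀ i, |((π i - i : ℤ) : ℝ)| ≤ R) (hR : |lam| * R ≤ 1) {a : ℤ → ℝ}
    (ha : Summable fun i => a i ^ 2) :
    Summable (fun i => ((2 * a i + Real.exp (lam * (i - π i : ℤ)) * a (π i) +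
      Real.exp (lam * (i - π.symm i : ℤ)) * a (π.symm i)) / 4) ^ 2) ∧
    ∑' i, ((2 * a i + Real.exp (lam * (i - π i : ℤ)) * a (π i) +
      Real.exp (lam * (i - π.symm i : ℤ)) * a (π.symm i)) / 4) ^ 2 ≤
      (1 + 4 * (lam * R) ^ 2) * ∑' i, a i ^ 2 := by
  set θ := |lam| * R with hθ
  have hθ2 : (lam * R) ^ 2 = θ ^ 2 := by rw [hθ, mul_pow, mul_pow, sq_abs]
  have ht : ∀ i, |lam * (i - π i : ℤ)| ≤ θ := by
    intro i
    rw [abs_mul, hθ]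
    have := hπ i
    rw [← abs_neg, ← Int.cast_neg, neg_sub] at this
    gcongr
  have ht' : ∀ i, |lam * (i - π.symm i : ℤ)| ≤ θ := by
    intro i
    have := ht (π.symm i)
    rw [π.apply_symm_apply, ← abs_neg, ← mul_neg, ← Int.cast_neg, neg_sub] at this
    exact this
  have hz : HasSum (fun i => a (π i) ^ 2) (∑' i, a i ^ 2) :=
    (Equiv.hasSum_iff (f := fun i => a i ^ 2) π).2 ha.hasSum
  have hx : HasSum (fun i => a (π.symm i) ^ 2) (∑' i, a i ^ 2) :=
    (Equiv.hasSum_iff (f := fun i => a i ^ 2) π.symm).2 ha.hasSum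
  -- First-order terms enter only as `Γ (π.symm i) - Γ i`, whose sum over `ℤ` is zero since `Γ` is
  -- summable. This is why the loss is quadratic in `lam * R`.
  let Γ : ℤ → ℝ := fun i => (Real.exp (-(lam * (i - π i : ℤ))) - 1) * a i * a (π i)
  have hΓ : Summable Γ := by
    refine Summable.of_norm_bounded (ha.add hz.summable) fun i => ?_
    have h1 := (exp_sub_one_bounds (t := -(lam * (i - π i : ℤ))) (by rw [abs_neg]; exact ht i)
      ‹θ ≤ 1›).1
    have h2 : |Real.exp (-(lam * (i - π i : ℤ))) - 1| ≤ 2 := by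
      refine abs_le_of_sq_le_sq ?_ (by norm_num)
      have : 0 ≤ θ := (abs_nonneg _).trans (ht i)
      nlinarith
    rw [Real.norm_eq_abs, abs_mul, abs_mul]
    calc _ ≤ 2 * |a i| * |a (π i)| := by gcongr
      _ ≤ _ := by nlinarith [sq_nonneg (|a i| - |a (π i)|), sq_abs (a i), sq_abs (a (π i))]
  have hΓ' : HasSum (fun i => Γ (π.symm i)) (∑' i, Γ i) :=
    (Equiv.hasSum_iff (f := Γ) π.symm).2 hΓ.hasSum
  have hB : HasSum (fun i => (2 * a i ^ 2 + (1 + 4 * θ ^ 2) * (a (π i) ^ 2 + a (π.symm i) ^ 2) +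
      4 * θ ^ 2 * (a i ^ 2 + a (π i) ^ 2) + 2 * (Γ (π.symm i) - Γ i)) / 4) _ :=
    ((((ha.hasSum.mul_left 2).add ((hz.add hx).mul_left (1 + 4 * θ ^ 2))).add
      ((ha.hasSum.add hz).mul_left (4 * θ ^ 2))).add
      ((hΓ'.sub hΓ.hasSum).mul_left 2)).div_const 4
  have hle : ∀ i, ((2 * a i + Real.exp (lam * (i - π i : ℤ)) * a (π i) +
      Real.exp (lam * (i - π.symm i : ℤ)) * a (π.symm i)) / 4) ^ 2 ≤
      (2 * a i ^ 2 + (1 + 4 * θ ^ 2) * (a (π i) ^ 2 + a (π.symm i) ^ 2) +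
      4 * θ ^ 2 * (a i ^ 2 + a (π i) ^ 2) + 2 * (Γ (π.symm i) - Γ i)) / 4 := by
    intro i
    have hΓi : Γ (π.symm i) = (Real.exp (lam * (i - π.symm i : ℤ)) - 1) * a (π.symm i) * a i := by
      simp only [Γ, π.apply_symm_apply]
      congr 4
      push_cast
      ring
    rw [hΓi]
    simp only [Γ]
    obtain ⟨hα, hα'⟩ := exp_sub_one_bounds (ht i) hR
    obtain ⟨hβ, -⟩ := exp_sub_one_bounds (ht' i) hR
    exact sq_twisted_le hα hα' hβ
  have hs := Summable.of_nonneg_of_le (fun _ => sq_nonneg _) hle hB.summable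
  refine ⟨hs, (hasSum_le hle hs.hasSum hB).trans_eq ?_⟩
  rw [hθ2]
  ring


theorem sum_lazyLetter {G S : Type*} [Group G] [Fintype S] (σ : S → G) (f : G → ℝ) :
    (∑ t, f (lazyLetter σ t)⁻¹) / Fintype.card (S × Fin 4) =
      (∑ s, (2 * f 1 + f (σ s) + f (σ s)⁻¹) / 4) / Fintype.card S := by
  rw [Fintype.sum_prod_type, Fintype.card_prod, Fintype.card_fin, ← Finset.sum_div, div_div]
  congr 1
  · refine Finset.sum_congr rfl fun s _ => ?_
    simp only [lazyLetter, Fin.sum_univ_four]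
    simp
    ring
  · push_cast; ring

section PermWalk

variable {S : Type*} [Fintype S] {π : S → Equiv.Perm ℤ}

/-- Conjugation by the weight `exp (lam * i)` turns a step of the walk into an average of the
twisted steps above, so each step costs one factor. -/
theorem tsum_weighted_walkLaw_sq_le [Nonempty S] {R lam : ℝ}
    (hπ : ∀ s i, |((π s i - i : ℤ) : ℝ)| ≤ R) (hR : |lam| * R ≤ 1) (n : ℕ) :
    Summable (fun i : ℤ => (Real.exp (lam * i) * walkLaw (lazyLetter π) (0 : ℤ) n i) ^ 2) ∧
      ∑' i : ℤ, (Real.exp (lam * i) * walkLaw (lazyLetter π) (0 : ℤ) n i) ^ 2 ≤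
        (1 + 4 * (lam * R) ^ 2) ^ n := by
  induction n with
  | zero =>
    rw [walkLaw_zero]
    have h0 : ∀ i : ℤ, i ≠ 0 → (Real.exp (lam * i) * (Pi.single 0 1 : ℤ → ℝ) i) ^ 2 = 0 :=
      fun i hi => by simp [Pi.single_eq_of_ne hi]
    refine ⟨summable_of_ne_finset_zero (s := {0}) fun i hi => h0 i (Finset.notMem_singleton.1 hi),
      ?_⟩
    rw [tsum_eq_single 0 h0]
    simp
  | succ n ih =>
    obtain ⟨hs, hle⟩ := ih
    have hc : (0 : ℝ) < Fintype.card S := by exact_mod_cast Fintype.card_pos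
    set v : ℤ → ℝ := fun i => Real.exp (lam * i) * walkLaw (lazyLetter π) (0 : ℤ) n i with hv
    let c : S → ℤ → ℝ := fun s i => (2 * v i + Real.exp (lam * (i - π s i : ℤ)) * v (π s i) +
      Real.exp (lam * (i - (π s).symm i : ℤ)) * v ((π s).symm i)) / 4
    have hstep : ∀ i : ℤ, Real.exp (lam * i) * walkLaw (lazyLetter π) (0 : ℤ) (n + 1) i =
        (∑ s, c s i) / Fintype.card S := by
      intro i
      rw [walkLaw_succ, sum_lazyLetter π fun g => walkLaw (lazyLetter π) (0 : ℤ) n (g • i),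
        ← mul_div_assoc, Finset.mul_sum]
      congr 1
      refine Finset.sum_congr rfl fun s _ => ?_
      have h1 : ∀ j : ℤ, Real.exp (lam * (i - j : ℤ)) * v j =
          Real.exp (lam * i) * walkLaw (lazyLetter π) (0 : ℤ) n j := by
        intro j
        rw [hv, ← mul_assoc, ← Real.exp_add]
        congr 3
        push_cast
        ring
      simp only [c, h1, one_smul, Equiv.Perm.smul_def]
      rw [hv, Equiv.Perm.inv_def]
      ring
    have hcs := fun s => tsum_sq_twisted_step_le (hπ s) hR hs
    have hB := (hasSum_sum fun s (_ : s ∈ Finset.univ) => (hcs s).1.hasSum).div_const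
      (Fintype.card S : ℝ)
    simp only [hstep]
    have hs' : Summable fun i => ((∑ s, c s i) / (Fintype.card S : ℝ)) ^ 2 :=
      summable_sq_avg fun s => (hcs s).1
    refine ⟨hs', (hasSum_le (fun i => sq_avg_le fun s => c s i) hs'.hasSum hB).trans ?_⟩
    rw [div_le_iff₀ hc, pow_succ']
    refine (Finset.sum_le_sum fun s _ => (hcs s).2).trans ?_
    simp only [Finset.sum_const, Finset.card_univ, nsmul_eq_mul]
    rw [mul_comm]
    gcongr

/-- Gaussian upper bound for the lazy symmetric walk on `ℤ` generated by permutations of bounded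
displacement. -/
theorem walkLaw_le_exp [Nonempty S] {R lam : ℝ} (hπ : ∀ s i, |((π s i - i : ℤ) : ℝ)| ≤ R)
    (h0 : 0 ≤ lam) (hR : lam * R ≤ 1) (n : ℕ) (y : ℤ) :
    walkLaw (lazyLetter π) (0 : ℤ) n y ≤ Real.exp (2 * (lam * R) ^ 2 * n - lam * |(y : ℝ)|) := by
  -- A single value is at most the weighted `ℓ²` norm; the square root halves the 4 in the exponent.
  -- The sign of `l` is then matched to that of `y`.
  have key : ∀ l : ℝ, |l| = lam → walkLaw (lazyLetter π) (0 : ℤ) n y ≤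
      Real.exp (2 * (lam * R) ^ 2 * n - l * y) := by
    intro l hl
    obtain ⟨hs, hle⟩ := tsum_weighted_walkLaw_sq_le (lam := l) hπ (by rwa [hl]) n
    have h1 := (hs.le_tsum y fun _ _ => sq_nonneg _).trans hle
    have h2 : (1 + 4 * (l * R) ^ 2) ^ n ≤ Real.exp (2 * (lam * R) ^ 2 * n) ^ 2 := by
      rw [mul_pow l, ← sq_abs l, hl, ← mul_pow, ← Real.exp_nat_mul]
      calc _ ≤ Real.exp (4 * (lam * R) ^ 2) ^ n := by
            gcongr
            linarith [Real.add_one_le_exp (4 * (lam * R) ^ 2)]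
        _ = _ := by rw [← Real.exp_nat_mul]; push_cast; ring_nf
    have h3 := (abs_le_of_sq_le_sq (h1.trans h2) (Real.exp_pos _).le)
    have h4 := (le_abs_self _).trans h3
    rw [Real.exp_sub, le_div_iff₀ (Real.exp_pos _), mul_comm]
    exact h4
  rcases abs_cases (y : ℝ) with ⟨h, -⟩ | ⟨h, -⟩
  · rw [h]
    exact key lam (abs_of_nonneg h0)
  · rw [h, mul_neg, ← neg_mul]
    exact key (-lam) (by rw [abs_neg, abs_of_nonneg h0])

/-- The walk on `ℤ` started at `0` leaves `[-m, m]` while reading the word `w` (from the right). -/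
def Exits {T : Type*} (ρ : T → Equiv.Perm ℤ) (m : ℕ) (w : List T) : Prop :=
  ∃ v, v <:+ w ∧ (m : ℤ) < |(v.map ρ).prod 0|

theorem exits_cons {T : Type*} {ρ : T → Equiv.Perm ℤ} {m : ℕ} {t : T} {w : List T} :
    Exits ρ m (t :: w) ↔ (m : ℤ) < |((t :: w).map ρ).prod 0| ∨ Exits ρ m w := by
  simp only [Exits, List.suffix_cons_iff, or_and_right, exists_or, exists_eq_left]

theorem wordAvg_tail {T : Type*} [Fintype T] [Nonempty T] (n : ℕ) (F : List T → ℝ) :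
    wordAvg (n + 1) (fun w => F w.tail) = wordAvg n F := by
  simp only [wordAvg, List.tail_cons, Finset.sum_const, Finset.card_univ, nsmul_eq_mul]
  field_simp

omit [Fintype S] in
theorem abs_lazyLetter_sub_le {R : ℕ} (hπ : ∀ s i, |π s i - i| ≤ R) (t : S × Fin 4) (i : ℤ) :
    |lazyLetter π t i - i| ≤ R := by
  obtain ⟨s, k⟩ := t
  fin_cases k
  · simp [lazyLetter]
  · simp [lazyLetter]
  · exact hπ s i
  · have := hπ s ((π s)⁻¹ i)
    rw [← Equiv.Perm.mul_apply, mul_inv_cancel, Equiv.Perm.one_apply, abs_sub_comm] at this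
    exact this

-- At the first exit the walk lands among the at most `2R` points with `m < |y| ≤ m + R`. A union
-- bound over times and landing points combines with the Gaussian estimate.
open Classical in
theorem wordAvg_exits_le [Nonempty S] {R : ℕ} {lam : ℝ} (hπ : ∀ s i, |π s i - i| ≤ R)
    (h0 : 0 ≤ lam) (hR : lam * R ≤ 1) (m n : ℕ) :
    wordAvg n (fun w => if Exits (lazyLetter π) m w then 1 else 0) ≤
      n * (2 * R * Real.exp (2 * (lam * R) ^ 2 * n - lam * m)) := by
  -- The horizon `N` in the exponent is frozen so that the induction on `k` adds equal terms.
  suffices ∀ N k, k ≤ N → wordAvg k (fun w => if Exits (lazyLetter π) m w then 1 else 0) ≤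
      k * (2 * R * Real.exp (2 * (lam * R) ^ 2 * N - lam * m)) from this n n le_rfl
  intro N k hk
  induction k with
  | zero =>
    have : ¬ (m : ℤ) < 0 := by omega
    simp [wordAvg, Exits, this]
  | succ k ih =>
    let I : Finset ℤ := Finset.Ioc (m : ℤ) (m + R) ∪ Finset.Ico (-(m + R : ℤ)) (-m)
    have hI : ∀ y : ℤ, y ∈ I ↔ (m : ℤ) < |y| ∧ |y| ≤ m + R := by
      intro y
      simp only [I, Finset.mem_union, Finset.mem_Ioc, Finset.mem_Ico]
      rcases abs_cases y with ⟨h, h'⟩ | ⟨h, h'⟩ <;> rw [h] <;> omega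
    have hIcard : (I.card : ℝ) ≤ 2 * R := by
      have : I.card ≤ 2 * R := by
        refine (Finset.card_union_le _ _).trans ?_
        simp only [Int.card_Ioc, Int.card_Ico]
        omega
      exact_mod_cast this
    have hle : ∀ w : List (S × Fin 4), w.length = k + 1 →
        (if Exits (lazyLetter π) m w then (1 : ℝ) else 0) ≤
          (if Exits (lazyLetter π) m w.tail then 1 else 0) +
          ∑ y ∈ I, if (w.map (lazyLetter π)).prod • (0 : ℤ) = y then 1 else 0 := by
      intro w hw
      obtain ⟨t, w, rfl⟩ := List.exists_cons_of_length_eq_add_one hw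
      rw [List.tail_cons, Finset.sum_ite_eq, exits_cons]
      by_cases hE : Exits (lazyLetter π) m w
      · simp only [hE, or_true, if_true]
        split_ifs <;> norm_num
      · simp only [hE, or_false, if_false, zero_add]
        by_cases hm : (m : ℤ) < |((t :: w).map (lazyLetter π)).prod 0|
        · have h1 : |(w.map (lazyLetter π)).prod 0| ≤ m := by
            by_contra! h
            exact hE ⟨w, List.suffix_rfl, h⟩
          have h2 := abs_lazyLetter_sub_le hπ t ((w.map (lazyLetter π)).prod 0)
          rw [List.map_cons, List.prod_cons, Equiv.Perm.mul_apply] at hm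
          rw [if_pos, if_pos]
          · rw [hI, Equiv.Perm.smul_def, List.map_cons, List.prod_cons, Equiv.Perm.mul_apply]
            refine ⟨hm, ?_⟩
            have := abs_add_le (lazyLetter π t ((w.map (lazyLetter π)).prod 0) -
              (w.map (lazyLetter π)).prod 0) ((w.map (lazyLetter π)).prod 0)
            rw [sub_add_cancel] at this
            linarith
          · rwa [List.map_cons, List.prod_cons, Equiv.Perm.mul_apply]
        · rw [if_neg hm]
          positivity
    refine (wordAvg_mono (k + 1) hle).trans ?_
    rw [wordAvg_add, wordAvg_tail k fun w => if Exits (lazyLetter π) m w then (1 : ℝ) else 0,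
      wordAvg_sum, Nat.cast_succ, add_mul, one_mul]
    refine add_le_add (ih (Nat.le_of_succ_le hk)) ?_
    have hy : ∀ y ∈ I, walkLaw (lazyLetter π) (0 : ℤ) (k + 1) y ≤
        Real.exp (2 * (lam * R) ^ 2 * N - lam * m) := by
      intro y hy
      refine (walkLaw_le_exp (fun s i => ?_) h0 hR (k + 1) y).trans ?_
      · exact_mod_cast hπ s i
      · have h1 : (m : ℝ) ≤ |(y : ℝ)| := by exact_mod_cast ((hI y).1 hy).1.le
        gcongr
    refine (Finset.sum_le_card_nsmul I _ _ hy).trans ?_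
    rw [nsmul_eq_mul]
    gcongr

end PermWalk


/-! ### From the full group to walks on orbits. -/

/-- A cocycle `k` with `g x = τ ^ k x • x` turns `g` into a permutation of the time axis of the
`τ`-orbit of `x`. -/
def cocyclePerm {X : Type*} [TopologicalSpace X] {τ g : X ≃ₜ X} {k : X → ℤ}
    (hk : ∀ x, g x = (τ ^ k x) x) (x : X) : Equiv.Perm ℤ where
  toFun i := i + k ((τ ^ i) x)
  invFun i := i - k (g.symm ((τ ^ i) x))
  left_inv i := by
    have h : (τ ^ (i + k ((τ ^ i) x))) x = g ((τ ^ i) x) := by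
      rw [hk, ← Homeomorph.mul_apply, ← zpow_add, add_comm]
    simp only [h, g.symm_apply_apply]
    ring
  right_inv i := by
    obtain ⟨z, hz⟩ := g.surjective ((τ ^ i) x)
    have h : (τ ^ (i - k z)) x = z := by
      have h1 : (τ ^ i) x = (τ ^ k z) z := by rw [← hz, hk]
      rw [sub_eq_neg_add, zpow_add, Homeomorph.mul_apply, h1, ← Homeomorph.mul_apply, ← zpow_add,
        neg_add_cancel, zpow_zero]
      rfl
    simp only [← hz, g.symm_apply_apply, h]
    ring

theorem cocyclePerm_apply {X : Type*} [TopologicalSpace X] {τ g : X ≃ₜ X} {k : X → ℤ}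
    (hk : ∀ x, g x = (τ ^ k x) x) (x : X) (i : ℤ) : cocyclePerm hk x i = i + k ((τ ^ i) x) := rfl

theorem zpow_cocyclePerm {X : Type*} [TopologicalSpace X] {τ g : X ≃ₜ X} {k : X → ℤ}
    (hk : ∀ x, g x = (τ ^ k x) x) (x : X) (i : ℤ) :
    (τ ^ (cocyclePerm hk x i)) x = g ((τ ^ i) x) := by
  rw [cocyclePerm_apply, hk, ← Homeomorph.mul_apply, ← zpow_add, add_comm]

/-- One random word drives the walks on all orbits at once: the group element is recovered from the
family of walks on `ℤ` indexed by `x`. -/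
theorem prod_lazyLetter_apply {X S : Type*} [TopologicalSpace X] {τ : X ≃ₜ X} {σ : S → X ≃ₜ X}
    {k : S → X → ℤ} (hk : ∀ s x, σ s x = (τ ^ k s x) x) (x : X) (w : List (S × Fin 4)) :
    (w.map (lazyLetter σ)).prod x =
      (τ ^ ((w.map (lazyLetter fun s => cocyclePerm (hk s) x)).prod 0)) x := by
  induction w with
  | nil => simp
  | cons t w ih =>
    rw [List.map_cons, List.prod_cons, List.map_cons, List.prod_cons, Homeomorph.mul_apply, ih,
      Equiv.Perm.mul_apply]
    generalize (w.map (lazyLetter fun s => cocyclePerm (hk s) x)).prod 0 = i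
    obtain ⟨s, c⟩ := t
    fin_cases c
    · rfl
    · rfl
    · exact (zpow_cocyclePerm (hk s) x i).symm
    · have h := zpow_cocyclePerm (hk s) x ((cocyclePerm (hk s) x)⁻¹ i)
      rw [← Equiv.Perm.mul_apply, mul_inv_cancel, Equiv.Perm.one_apply] at h
      change (σ s).symm ((τ ^ i) x) = (τ ^ ((cocyclePerm (hk s) x)⁻¹ i)) x
      rw [h, Homeomorph.symm_apply_apply]

/-! ### Windows and locality of the cocycles. -/

namespace SymbolicDynamics.FullShift.Subshift

variable {A : Type*} [TopologicalSpace A] {Y : Subshift A ℤ}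

theorem zpow_shiftHomeomorph_apply (k : ℤ) (x : Y.carrier) (n : ℤ) :
    ((Y.shiftHomeomorph ^ k) x).1 n = x.1 (k + n) := by
  induction k generalizing n with
  | zero => simp
  | succ k ih =>
    rw [add_comm (k : ℤ) 1, zpow_one_add, Homeomorph.mul_apply]
    change ((Y.shiftHomeomorph ^ (k : ℤ)) x).1 (1 + n) = _
    rw [ih]
    ring_nf
  | pred k ih =>
    rw [sub_eq_neg_add, zpow_add, zpow_neg_one, Homeomorph.mul_apply]
    change ((Y.shiftHomeomorph ^ (-k : ℤ)) x).1 (-1 + n) = _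
    rw [ih]
    ring_nf

/-- The word of `x` in the window `[-r, r]`. -/
def window (r : ℕ) (x : Y.carrier) : Fin (2 * r + 1) → A := fun j => x.1 (-r + (j : ℕ))

theorem window_mem_words (r : ℕ) (x : Y.carrier) : window r x ∈ Y.words (2 * r + 1) :=
  ⟨x.1, x.2, -r, fun _ => rfl⟩

theorem window_eq_iff {r : ℕ} {x y : Y.carrier} :
    window r x = window r y ↔ ∀ i : ℤ, |i| ≤ r → x.1 i = y.1 i := by
  constructor
  · intro h i hi
    rw [abs_le] at hi
    have := congrFun h ⟨(i + r).toNat, by omega⟩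
    simp only [window] at this
    rwa [Int.toNat_of_nonneg (by omega), neg_add_cancel_comm_assoc] at this
  · intro h
    ext j
    refine h _ ?_
    rw [abs_le]
    have := j.2
    omega

theorem exists_window_eq {r : ℕ} {u : Fin (2 * r + 1) → A} (hu : u ∈ Y.words (2 * r + 1)) :
    ∃ x : Y.carrier, window r x = u := by
  obtain ⟨x, hx, i, hi⟩ := hu
  refine ⟨(Y.shiftHomeomorph ^ (i + r)) ⟨x, hx⟩, ?_⟩
  ext j
  have h : i + r + (-(r : ℤ) + (j : ℕ)) = i + (j : ℕ) := by ring
  rw [window, zpow_shiftHomeomorph_apply, h]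
  exact hi j

theorem window_eq_of_le {r r' : ℕ} (h : r ≤ r') {x y : Y.carrier}
    (hxy : window r' x = window r' y) : window r x = window r y := by
  rw [window_eq_iff] at *
  exact fun i hi => hxy i (hi.trans (by exact_mod_cast h))

theorem window_zpow_eq {m r : ℕ} {x y : Y.carrier} (h : window (m + r) x = window (m + r) y)
    {i : ℤ} (hi : |i| ≤ m) :
    window r ((Y.shiftHomeomorph ^ i) x) = window r ((Y.shiftHomeomorph ^ i) y) := by
  rw [window_eq_iff] at *
  intro j hj
  rw [zpow_shiftHomeomorph_apply, zpow_shiftHomeomorph_apply]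
  exact h _ ((abs_add_le i j).trans (by push_cast; gcongr))

theorem exists_window_subset {U : Set Y.carrier} (hU : IsOpen U) {x : Y.carrier} (hx : x ∈ U) :
    ∃ r, ∀ y, window r y = window r x → y ∈ U := by
  obtain ⟨V, hV, rfl⟩ := isOpen_induced_iff.1 hU
  obtain ⟨I, u, hu, hI⟩ := isOpen_pi_iff.1 hV x.1 hx
  refine ⟨I.sup Int.natAbs, fun y hy => hI fun i hi => ?_⟩
  have : |i| ≤ (I.sup Int.natAbs : ℕ) := by
    rw [Int.abs_eq_natAbs]
    exact_mod_cast Finset.le_sup (f := Int.natAbs) hi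
  rw [window_eq_iff.1 hy i this]
  exact (hu i hi).2

theorem isOpen_window [DiscreteTopology A] (r : ℕ) (x : Y.carrier) :
    IsOpen {y : Y.carrier | window r y = window r x} := by
  have : Continuous (window r : Y.carrier → _) :=
    continuous_pi fun j => (continuous_apply _).comp continuous_subtype_val
  exact (isOpen_discrete {window r x}).preimage this

/-- Compactness makes the local radii and exponents uniform. -/
theorem exists_cocycle [Finite A] [DiscreteTopology A] {g : Y.carrier ≃ₜ Y.carrier}
    (hg : g ∈ topologicalFullGroup Y.shiftHomeomorph) :
    ∃ (r : ℕ) (k : Y.carrier → ℤ), (∀ x, g x = (Y.shiftHomeomorph ^ k x) x) ∧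
      (∀ x, |k x| ≤ r) ∧ ∀ x y, window r x = window r y → k x = k y := by
  have : CompactSpace Y.carrier := isCompact_iff_compactSpace.1 Y.isClosed.isCompact
  have key : ∃ r : ℕ, ∀ x ∈ (Set.univ : Set Y.carrier), ∃ k : ℤ, |k| ≤ r ∧
      ∀ y, window r y = window r x → g y = (Y.shiftHomeomorph ^ k) y := by
    refine isCompact_univ.induction_on (p := fun K => ∃ r : ℕ, ∀ x ∈ K, ∃ k : ℤ, |k| ≤ r ∧
      ∀ y, window r y = window r x → g y = (Y.shiftHomeomorph ^ k) y) ?_ ?_ ?_ ?_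
    · exact ⟨0, fun x hx => hx.elim⟩
    · rintro K K' hK ⟨r, hr⟩
      exact ⟨r, fun x hx => hr x (hK hx)⟩
    · rintro K K' ⟨r, hr⟩ ⟨r', hr'⟩
      refine ⟨max r r', fun x hx => ?_⟩
      rcases hx with hx | hx
      · obtain ⟨k, hk, h⟩ := hr x hx
        exact ⟨k, hk.trans (by exact_mod_cast le_max_left r r'),
          fun y hy => h y (window_eq_of_le (le_max_left r r') hy)⟩
      · obtain ⟨k, hk, h⟩ := hr' x hx
        exact ⟨k, hk.trans (by exact_mod_cast le_max_right r r'),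
          fun y hy => h y (window_eq_of_le (le_max_right r r') hy)⟩
    · intro x _
      obtain ⟨U, hU, hxU, k, hk⟩ := hg x
      obtain ⟨r, hr⟩ := exists_window_subset hU hxU
      refine ⟨_, mem_nhdsWithin_of_mem_nhds ((isOpen_window r x).mem_nhds rfl),
        max r k.natAbs, fun z hz => ⟨k, ?_, fun y hy => hk y (hr y ?_)⟩⟩
      · rw [Int.abs_eq_natAbs]
        exact_mod_cast le_max_right r _
      · exact (window_eq_of_le (le_max_left r _) hy).trans hz
  obtain ⟨r, hr⟩ := key
  -- The exponent is selected per word rather than per point: at a periodic point it is not unique,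
  -- and a pointwise choice need not be local. Words that do not occur receive 0.
  have hκ : ∀ u : Fin (2 * r + 1) → A, ∃ k : ℤ, |k| ≤ r ∧
      ∀ y, window r y = u → g y = (Y.shiftHomeomorph ^ k) y := by
    intro u
    by_cases hu : ∃ x : Y.carrier, window r x = u
    · obtain ⟨x, rfl⟩ := hu
      exact hr x trivial
    · exact ⟨0, by simp, fun y hy => (hu ⟨y, hy⟩).elim⟩
  choose κ hκ hκ' using hκ
  exact ⟨r, fun x => κ (window r x), fun x => hκ' _ x rfl, fun x => hκ _,
    fun x y h => congrArg κ h⟩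

theorem walk_eq_of_window_eq {S : Type*} {σ : S → Y.carrier ≃ₜ Y.carrier} {k : S → Y.carrier → ℤ}
    (hk : ∀ s x, σ s x = (Y.shiftHomeomorph ^ k s x) x) {r m : ℕ}
    (hr : ∀ s x y, window r x = window r y → k s x = k s y) {x y : Y.carrier}
    (hxy : window (m + r) x = window (m + r) y) {w : List (S × Fin 4)}
    (hw : ¬ Exits (lazyLetter fun s => cocyclePerm (hk s) x) m w) :
    (w.map (lazyLetter fun s => cocyclePerm (hk s) y)).prod 0 =
      (w.map (lazyLetter fun s => cocyclePerm (hk s) x)).prod 0 := by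
  induction w with
  | nil => rfl
  | cons t w ih =>
    rw [exits_cons, not_or, not_lt, List.map_cons, List.prod_cons, Equiv.Perm.mul_apply] at hw
    rw [List.map_cons, List.prod_cons, List.map_cons, List.prod_cons, Equiv.Perm.mul_apply,
      Equiv.Perm.mul_apply, ih hw.2]
    have hi : |(w.map (lazyLetter fun s => cocyclePerm (hk s) x)).prod 0| ≤ m := by
      by_contra! h
      exact hw.2 ⟨w, List.suffix_rfl, h⟩
    have hw1 := hw.1
    generalize (w.map (lazyLetter fun s => cocyclePerm (hk s) x)).prod 0 = i at *
    have hloc : ∀ s (j : ℤ), |j| ≤ m → cocyclePerm (hk s) y j = cocyclePerm (hk s) x j := by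
      intro s j hj
      rw [cocyclePerm_apply, cocyclePerm_apply, hr s _ _ (window_zpow_eq hxy hj)]
    obtain ⟨s, c⟩ := t
    fin_cases c
    · rfl
    · rfl
    · exact hloc s i hi
    -- For an inverse letter the cocycle is read at the arrival point, which lies in `[-m, m]`
    -- because the new position has not exited either.
    · change |(cocyclePerm (hk s) x)⁻¹ i| ≤ m at hw1
      change (cocyclePerm (hk s) y)⁻¹ i = (cocyclePerm (hk s) x)⁻¹ i
      rw [Equiv.Perm.inv_eq_iff_eq, hloc s _ hw1, ← Equiv.Perm.mul_apply, mul_inv_cancel,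
        Equiv.Perm.one_apply]

end SymbolicDynamics.FullShift.Subshift


/-! ### Counting the group elements reached without exit. -/

namespace SymbolicDynamics.FullShift.Subshift

variable {A : Type*} [TopologicalSpace A] {Y : Subshift A ℤ}

theorem coe_prod_lazyLetter {G S : Type*} [Group G] {H : Subgroup G} (σ : S → H)
    (w : List (S × Fin 4)) :
    ((w.map (lazyLetter σ)).prod : G) = (w.map (lazyLetter fun s => (σ s : G))).prod := by
  induction w with
  | nil => rfl
  | cons t w ih =>
    rw [List.map_cons, List.prod_cons, List.map_cons, List.prod_cons, Subgroup.coe_mul, ih]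
    obtain ⟨s, c⟩ := t
    congr 1
    fin_cases c <;> rfl

-- The hypothesis `hρ` is the union bound: with probability at least 1/2 no representative exits,
-- and then the walk lies in a finite set of at most `(2m+1)^ρ` elements, to which Cauchy–Schwarz
-- applies.
open Classical in
theorem one_le_card_mul_tsum_walkLaw_sq [Finite A] {S : Type*} [Fintype S] [Nonempty S]
    {H : Subgroup (Y.carrier ≃ₜ Y.carrier)} {σ : S → H} {k : S → Y.carrier → ℤ}
    (hk : ∀ s x, (σ s : Y.carrier ≃ₜ Y.carrier) x = (Y.shiftHomeomorph ^ k s x) x) {r : ℕ}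
    (hkr : ∀ s x, |k s x| ≤ r) (hr : ∀ s x y, window r x = window r y → k s x = k s y)
    {lam : ℝ} (h0 : 0 ≤ lam) (hlam : lam * r ≤ 1) (m n : ℕ)
    (hρ : Y.complexity (2 * (m + r) + 1) *
      (n * (2 * r * Real.exp (2 * (lam * r) ^ 2 * n - lam * m))) ≤ 1 / 2) :
    1 / 4 ≤ (2 * m + 1 : ℝ) ^ Y.complexity (2 * (m + r) + 1) *
      ∑' g, walkLaw (lazyLetter σ) (1 : H) n g ^ 2 := by
  let U := Y.words (2 * (m + r) + 1)
  have : Fintype U := Fintype.ofFinite U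
  have hU : Fintype.card U = Y.complexity (2 * (m + r) + 1) := by
    rw [complexity, ← Nat.card_coe_set_eq, Nat.card_eq_fintype_card]
  choose x hx using fun u : U => exists_window_eq u.2
  let X : Y.carrier → List (S × Fin 4) → ℤ := fun x w =>
    (w.map (lazyLetter fun s => cocyclePerm (hk s) x)).prod 0
  let E : U → List (S × Fin 4) → Prop := fun u =>
    Exits (lazyLetter fun s => cocyclePerm (hk s) (x u)) m
  have hE : ∀ u, wordAvg n (fun w => if E u w then (1 : ℝ) else 0) ≤
      n * (2 * r * Real.exp (2 * (lam * r) ^ 2 * n - lam * m)) := fun u =>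
    wordAvg_exits_le (fun s i => by rw [cocyclePerm_apply, add_sub_cancel_left]; exact hkr _ _)
      h0 hlam m n
  have hX : ∀ w, (∀ u, ¬ E u w) → ∀ y, ∀ u : U, window (m + r) y = u → X y w = X (x u) w :=
    fun w hw y u hy => walk_eq_of_window_eq hk hr ((hx u).trans hy.symm) (hw u)
  have heq : ∀ w w', (∀ u, ¬ E u w) → (∀ u, ¬ E u w') → (∀ u, X (x u) w = X (x u) w') →
      (w.map (lazyLetter σ)).prod = (w'.map (lazyLetter σ)).prod := by
    intro w w' hw hw' h
    refine Subtype.ext (Homeomorph.ext fun y => ?_)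
    rw [coe_prod_lazyLetter, coe_prod_lazyLetter, prod_lazyLetter_apply hk,
      prod_lazyLetter_apply hk]
    change (Y.shiftHomeomorph ^ X y w) y = (Y.shiftHomeomorph ^ X y w') y
    let u : U := ⟨window (m + r) y, window_mem_words _ y⟩
    rw [hX w hw y u rfl, hX w' hw' y u rfl, h]
  -- A vector of final positions is decoded by any non-exiting word realizing it; `heq` makes the
  -- choice immaterial. Unrealized vectors go to 1, which can only enlarge the image harmlessly.
  let Φ : (U → Finset.Icc (-m : ℤ) m) → H := fun φ =>
    if h : ∃ w, (∀ u, ¬ E u w) ∧ ∀ u, X (x u) w = φ u then (h.choose.map (lazyLetter σ)).prod else 1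
  let F : Finset H := Finset.univ.image Φ
  have hF : (F.card : ℝ) ≤ (2 * m + 1 : ℝ) ^ Y.complexity (2 * (m + r) + 1) := by
    have h1 : F.card ≤ (2 * m + 1) ^ Y.complexity (2 * (m + r) + 1) := by
      refine Finset.card_image_le.trans ?_
      rw [Finset.card_univ, Fintype.card_fun, hU, Fintype.card_coe, Int.card_Icc]
      refine Nat.pow_le_pow_left ?_ _
      omega
    exact_mod_cast h1
  have hmem : ∀ w, (∀ u, ¬ E u w) → (w.map (lazyLetter σ)).prod ∈ F := by
    intro w hw
    have hXm : ∀ u, X (x u) w ∈ Finset.Icc (-m : ℤ) m := by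
      intro u
      rw [Finset.mem_Icc, ← abs_le]
      by_contra! h
      exact hw u ⟨w, List.suffix_rfl, h⟩
    refine Finset.mem_image.2 ⟨fun u => ⟨_, hXm u⟩, Finset.mem_univ _, ?_⟩
    have h : ∃ w', (∀ u, ¬ E u w') ∧ ∀ u, X (x u) w' = X (x u) w := ⟨w, hw, fun _ => rfl⟩
    simp only [Φ]
    rw [dif_pos h]
    exact heq _ _ h.choose_spec.1 hw h.choose_spec.2
  have hsum : 1 / 2 ≤ ∑ g ∈ F, walkLaw (lazyLetter σ) (1 : H) n g := by
    have h1 : (1 : ℝ) ≤ wordAvg n (fun w => ∑ u, if E u w then (1 : ℝ) else 0) +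
        ∑ g ∈ F, walkLaw (lazyLetter σ) (1 : H) n g := by
      simp only [walkLaw]
      rw [← wordAvg_sum, ← wordAvg_add]
      refine (wordAvg_const (T := S × Fin 4) n 1).ge.trans (wordAvg_mono n fun w _ => ?_)
      have h2 : ∀ u, (0 : ℝ) ≤ if E u w then (1 : ℝ) else 0 := fun u => by positivity
      rw [Finset.sum_ite_eq, smul_eq_mul, mul_one]
      by_cases hw : ∀ u, ¬ E u w
      · rw [if_pos (hmem w hw)]
        linarith [Finset.sum_nonneg fun u (_ : u ∈ Finset.univ) => h2 u]
      · push Not at hw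
        obtain ⟨u, hu⟩ := hw
        have h3 := Finset.single_le_sum (fun u _ => h2 u) (Finset.mem_univ u)
        rw [if_pos hu] at h3
        have h4 : (0 : ℝ) ≤ if (w.map (lazyLetter σ)).prod ∈ F then (1 : ℝ) else 0 := by positivity
        linarith
    have h2 : wordAvg n (fun w => ∑ u, if E u w then (1 : ℝ) else 0) ≤ 1 / 2 := by
      rw [wordAvg_sum]
      refine (Finset.sum_le_card_nsmul _ _ _ fun u _ => hE u).trans ?_
      rwa [nsmul_eq_mul, Finset.card_univ, hU]
    linarith
  have hcs := sq_sum_le_card_mul_sum_sq (s := F) (f := walkLaw (lazyLetter σ) (1 : H) n)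
  have htsum := (summable_walkLaw_sq (lazyLetter σ) (1 : H) n).sum_le_tsum F
    fun _ _ => sq_nonneg _
  have h5 : 1 / 4 ≤ (∑ g ∈ F, walkLaw (lazyLetter σ) (1 : H) n g) ^ 2 := by nlinarith
  refine h5.trans (hcs.trans ?_)
  gcongr

end SymbolicDynamics.FullShift.Subshift

/-! ### Choice of parameters and conclusion. -/

/-- Choice of the time scale `n ≈ m² / log m` for exiting a window of size `m`. -/
theorem exists_time_scale {ρ : ℕ → ℕ}
    (hρ : Tendsto (fun n : ℕ => (Real.log n / n) ^ 2 * (ρ n : ℝ)) atTop (𝓝 0)) (r : ℕ) {ε : ℝ}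
    (hε : 0 < ε) (N : ℕ) : ∃ (m n : ℕ) (lam : ℝ), N ≤ n ∧ 0 ≤ lam ∧ lam * r ≤ 1 ∧
      ρ (2 * (m + r) + 1) * (n * (2 * r * Real.exp (2 * (lam * r) ^ 2 * n - lam * m))) ≤ 1 / 2 ∧
      ρ (2 * (m + r) + 1) * Real.log (2 * m + 1) ≤ ε * n := by
  -- With `lam = 12 L / m` and `n ≤ c m² / L`, this `c` gives `2 (lam r)² n ≤ 6 L`, half of `lam * m
  -- = 12 L`.
  set c : ℝ := 1 / (48 * ((r : ℝ) + 1) ^ 2) with hc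
  have hc0 : 0 < c := by positivity
  have hc1 : c ≤ 1 := by
    rw [hc, div_le_one (by positivity)]
    nlinarith [(Nat.cast_nonneg r : (0 : ℝ) ≤ r)]
  -- The bound 1 yields `ρ ≤ 9 m²`. In the other, 36 absorbs the 9 from `2(m+r)+1 ≤ 3m` and the two
  -- factors 2 from `log (2m+1) ≤ 2L` and from the floor in `n`.
  set δ : ℝ := min 1 (ε * c / 36) with hδ
  have hδ0 : 0 < δ := lt_min one_pos (by positivity)
  have hscale : Tendsto (fun m : ℕ => 2 * (m + r) + 1) atTop atTop :=
    tendsto_atTop_mono (fun m => by dsimp only [id]; omega) tendsto_id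
  have hlog := (Real.isLittleO_log_id_atTop.bound (c := 1 / (12 * ((r : ℝ) + 1)))
    (by positivity)).natCast_atTop
  obtain ⟨m, h1, h2, h3, h4, h5⟩ := ((hscale.eventually (hρ.eventually_lt_const hδ0)).and
    (hlog.and ((eventually_ge_atTop (36 * r + 3)).and
    ((tendsto_natCast_atTop_atTop.const_mul_atTop hc0).eventually_ge_atTop 2 |>.and
    ((tendsto_natCast_atTop_atTop.const_mul_atTop hc0).eventually_ge_atTop (N + 1 : ℝ)))))).exists
  set ρm : ℝ := (ρ (2 * (m + r) + 1) : ℝ) with hρm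
  have hρ0 : 0 ≤ ρm := Nat.cast_nonneg _
  have hm3 : (36 * r + 3 : ℝ) ≤ m := by exact_mod_cast h3
  have hr0 : (0 : ℝ) ≤ r := Nat.cast_nonneg r
  have hm0 : (0 : ℝ) < m := by linarith
  set L := Real.log m with hL
  have hL1 : 1 ≤ L := by
    rw [hL, Real.le_log_iff_exp_le hm0]
    linarith [Real.exp_one_lt_d9]
  have hL0 : 0 < L := by linarith
  have hLm : L ≤ m := by linarith [Real.log_le_sub_one_of_pos hm0]
  have hcard : L ^ 2 * ρm ≤ 9 * δ * m ^ 2 := by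
    have hN0 : (0 : ℝ) < (2 * (m + r) + 1 : ℕ) := by positivity
    have hNm : ((2 * (m + r) + 1 : ℕ) : ℝ) ≤ 3 * m := by push_cast; linarith
    have hmN : (m : ℝ) ≤ (2 * (m + r) + 1 : ℕ) := by push_cast; linarith
    have hLN : L ≤ Real.log (2 * (m + r) + 1 : ℕ) := Real.log_le_log hm0 hmN
    rw [div_pow, div_mul_eq_mul_div, div_lt_iff₀ (by positivity)] at h1
    calc L ^ 2 * ρm ≤ Real.log (2 * (m + r) + 1 : ℕ) ^ 2 * ρm := by gcongr
      _ ≤ δ * ((2 * (m + r) + 1 : ℕ) : ℝ) ^ 2 := h1.le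
      _ ≤ δ * (3 * m) ^ 2 := by gcongr
      _ = _ := by ring
  set n := ⌊c * m ^ 2 / L⌋₊ with hn
  have hnle : (n : ℝ) ≤ c * m ^ 2 / L := Nat.floor_le (by positivity)
  have hnge : c * m ^ 2 / L - 1 ≤ n := (Nat.sub_one_lt_floor _).le
  have hcm : c * m ≤ c * m ^ 2 / L := by
    rw [le_div_iff₀ hL0, sq, ← mul_assoc]
    gcongr
  refine ⟨m, n, 12 * L / m, ?_, by positivity, ?_, ?_, ?_⟩
  · have : (N : ℝ) ≤ n := by linarith
    exact_mod_cast this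
  · rw [div_mul_eq_mul_div, div_le_one hm0]
    simp only [Real.norm_eq_abs, id_eq, Nat.abs_cast] at h2
    have h6 := (le_abs_self _).trans h2
    rw [div_mul_eq_mul_div, one_mul, le_div_iff₀ (by positivity)] at h6
    nlinarith
  · have hexp : Real.exp (2 * (12 * L / m * r) ^ 2 * n - 12 * L / m * m) ≤ 1 / (m : ℝ) ^ 6 := by
      have h6 : 2 * (12 * L / m * r) ^ 2 * n ≤ 6 * L := by
        calc 2 * (12 * L / m * r) ^ 2 * n ≤ 2 * (12 * L / m * (r + 1)) ^ 2 * (c * m ^ 2 / L) := by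
              gcongr
              linarith
          _ = 6 * L := by rw [hc]; field_simp; norm_num
      have h7 : 12 * L / m * m = 12 * L := by field_simp
      have h8 : Real.exp (6 * L) = (m : ℝ) ^ 6 := by
        rw [← Real.exp_log hm0, ← Real.exp_nat_mul, hL]
        norm_num
      rw [one_div, ← h8, ← Real.exp_neg, Real.exp_le_exp]
      linarith
    have hρm9 : ρm ≤ 9 * m ^ 2 := by
      have h6 : ρm ≤ L ^ 2 * ρm := le_mul_of_one_le_left hρ0 (one_le_pow₀ hL1)
      have h7 : 9 * δ * (m : ℝ) ^ 2 ≤ 9 * 1 * (m : ℝ) ^ 2 := by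
        gcongr
        exact min_le_left _ _
      linarith
    have hnm : (n : ℝ) ≤ m ^ 2 := by
      refine hnle.trans ?_
      rw [div_le_iff₀ hL0]
      calc c * (m : ℝ) ^ 2 ≤ 1 * m ^ 2 := by gcongr
        _ ≤ m ^ 2 * L := by rw [one_mul]; exact le_mul_of_one_le_right (by positivity) hL1
    -- The decay `m⁻⁶` beats `ρ ≤ 9 m²` and `n ≤ m²` with `m⁻²` to spare.
    calc ρm * (n * (2 * r * Real.exp (2 * (12 * L / m * r) ^ 2 * n - 12 * L / m * m)))
        ≤ 9 * m ^ 2 * (m ^ 2 * (2 * r * (1 / (m : ℝ) ^ 6))) := by gcongr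
      _ = 18 * r / m ^ 2 := by field_simp; ring
      _ ≤ 1 / 2 := by
        rw [div_le_iff₀ (by positivity)]
        nlinarith
  · have h6 : Real.log (2 * m + 1) ≤ 2 * L := by
      have : Real.log ((m : ℝ) ^ 2) = 2 * L := by rw [Real.log_pow, hL]; norm_num
      rw [← this]
      refine Real.log_le_log (by positivity) ?_
      nlinarith
    have h7 : c * m ^ 2 / (2 * L) ≤ n := by
      have : c * m ^ 2 / (2 * L) = c * m ^ 2 / L / 2 := by field_simp
      rw [this]
      linarith
    have h8 : 9 * δ * (m : ℝ) ^ 2 ≤ ε * c / 4 * m ^ 2 := by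
      have : δ ≤ ε * c / 36 := min_le_right _ _
      nlinarith [sq_nonneg (m : ℝ)]
    calc ρm * Real.log (2 * m + 1) ≤ ρm * (2 * L) := by gcongr
      _ = 2 * (L ^ 2 * ρm) / L := by field_simp
      _ ≤ 2 * (ε * c / 4 * m ^ 2) / L := by
        have h9 := hcard.trans h8
        exact div_le_div_of_nonneg_right (by linarith) hL0.le
      _ = ε * (c * m ^ 2 / (2 * L)) := by field_simp; norm_num
      _ ≤ ε * n := by gcongr

theorem corollary3 {A : Type*} [Finite A] [TopologicalSpace A] [DiscreteTopology A]
    (Y : SymbolicDynamics.FullShift.Subshift A ℤ)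
    (hiso : ∀ x ∈ Function.periodicPts Y.shiftHomeomorph, ¬ IsOpen ({x} : Set Y.carrier))
    (hρ : Tendsto (fun n : ℕ => (Real.log n / n) ^ 2 * (Y.complexity n : ℝ)) atTop (𝓝 0)) :
    IsAmenable (topologicalFullGroup Y.shiftHomeomorph) := by
  classical
  refine isAmenable_of_walkLaw fun S => ?_
  let S' : Finset (topologicalFullGroup Y.shiftHomeomorph) := insert 1 S
  have hne : Nonempty S' := ⟨⟨1, Finset.mem_insert_self 1 S⟩⟩
  refine ⟨S' × Fin 4, inferInstance, inferInstance, lazyLetter (fun s : S' => s.1),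
    fun g hg => ⟨(⟨g, Finset.mem_insert_of_mem hg⟩, 2), rfl⟩, ⟨(hne.some, 0), rfl⟩, fun ε hε => ?_⟩
  choose r₀ k hk hkr hr using fun s : S' =>
    SymbolicDynamics.FullShift.Subshift.exists_cocycle s.1.2
  let r := Finset.univ.sup r₀
  have hle : ∀ s, r₀ s ≤ r := fun s => Finset.le_sup (Finset.mem_univ s)
  rw [frequently_atTop]
  intro N
  obtain ⟨m, n, lam, hN, h0, hlam, h1, h2⟩ := exists_time_scale hρ r hε N
  refine ⟨n, hN, ?_⟩
  have key := SymbolicDynamics.FullShift.Subshift.one_le_card_mul_tsum_walkLaw_sq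
    (σ := fun s : S' => s.1) hk (fun s x => (hkr s x).trans (by exact_mod_cast hle s))
    (fun s x y h => hr s x y (SymbolicDynamics.FullShift.Subshift.window_eq_of_le (hle s) h))
    h0 hlam m n h1
  -- At the chosen scale the count of reachable elements is subexponential in `n`, which bounds the
  -- squared norm below by `exp (-ε n) / 4`.
  have h3 : (2 * m + 1 : ℝ) ^ Y.complexity (2 * (m + r) + 1) ≤ Real.exp (ε * n) := by
    rw [← Real.exp_log (show (0 : ℝ) < 2 * m + 1 by positivity), ← Real.exp_nat_mul]
    exact Real.exp_le_exp.2 h2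
  rw [neg_mul, Real.exp_neg, div_le_iff₀ (by norm_num), inv_le_iff_one_le_mul₀ (Real.exp_pos _)]
  have h4 : 0 ≤ ∑' g, walkLaw (lazyLetter fun s : S' => s.1)
      (1 : topologicalFullGroup Y.shiftHomeomorph) n g ^ 2 :=
    tsum_nonneg fun _ => sq_nonneg _
  have h5 := mul_le_mul_of_nonneg_right h3 h4
  linarith
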